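/- Let $d\ge1$ and $N\ge1$ be integers. For $k\ge 0$ and $x_1,\dots,x_k\in\mathbb{R}^d$ put $c_k(x_1,\dots,x_k)=\sum_{1\le i<j\le k}\frac1{|x_i-x_j|}\in[0,+\infty]$ (with $1/0=+\infty$). For a Borel probability measure $\rho$ on $\mathbb{R}^d$ let $$C(\rho)=\inf\Big\{\int c_N\,dP\ :\ P \text{ a Borel probability measure on } (\mathbb{R}^d)^N \text{ all of whose } N \text{ marginals on } \mathbb{R}^d \text{ equal } \rho\Big\}.$$ Let $\mathcal P^-$ be the set of nonnegative Borel measures $\rho$ on $\mathbb{R}^d$ with total mass $\|\rho\|\le 1$, let $C_0$ be the space of real continuous functions on $\mathbb{R}^d$ vanishing at infinity, and for $\rho\in\mathcal P^-$ let $$\overline C(\rho)=\inf\Big\{\liminf_{n\to\infty} C(\rho_n)\ :\ \rho_n \text{ probability measures},\ \int\varphi\,d\rho_n\to\int\varphi\,d\rho \text{ for all } \varphi\in C_0\Big\}.$$ For $\varphi\in C_0$ and $k\ge1$ let $$M_k(\varphi)=\sup\Big\{\frac1k\sum_{i=1}^k\varphi(x_i)-c_k(x_1,\dots,x_k)\ :\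 x_1,\dots,x_k\in\mathbb{R}^d\Big\},$$ and let $M_0=0$. Suppose that $V\in C_0$ satisfies $$M_N(V)>M_{N-1}\Big(\frac{N-1}{N}V\Big).$$ Then every minimizer $\rho$ of $\overline C(\rho)-\int V\,d\rho$ over $\mathcal P^-$ satisfies $\|\rho\|=1$, that is, it is a probability measure. Moreover, the supremum defining $M_N(V)$ is attained at some point of $(\mathbb{R}^d)^N$. -/

import Mathlib

open MeasureTheory Filter Topology
open scoped ENNReal ZeroAtInfty

noncomputable section

namespace CoulombOT

/-- The Coulomb cost `c_k(x₁,…,x_k) = ∑_{i<j} 1/|x_i - x_j|` of `k` points of `ℝ^d`, with values in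
`[0,∞]`; it is `∞` as soon as two of the points coincide. -/
def cost {d : ℕ} (k : ℕ) (x : Fin k → EuclideanSpace ℝ (Fin d)) : ℝ≥0∞ :=
  ∑ i : Fin k, ∑ j ∈ Finset.Ioi i, (edist (x i) (x j))⁻¹

/-- The transport plans `Π(ρ)`: Borel probabilities on `(ℝ^d)^N` all of whose marginals are `ρ`. -/
def plans {d : ℕ} (N : ℕ) (ρ : Measure (EuclideanSpace ℝ (Fin d))) :
    Set (Measure (Fin N → EuclideanSpace ℝ (Fin d))) :=
  {P | IsProbabilityMeasure P ∧ ∀ i : Fin N, P.map (fun x => x i) = ρ}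

/-- The multi-marginal transport cost `C(ρ)`, the infimum of `∫ c_N dP` over `P ∈ Π(ρ)`. -/
def transportCost {d : ℕ} (N : ℕ) (ρ : Measure (EuclideanSpace ℝ (Fin d))) : ℝ≥0∞ :=
  ⨅ P ∈ plans N ρ, ∫⁻ x, cost N x ∂P

/-- Weak* convergence of measures on `ℝ^d`, that is, convergence of the integrals of every
continuous function vanishing at infinity. -/
def WeakStarTendsto {d : ℕ} (ρs : ℕ → Measure (EuclideanSpace ℝ (Fin d)))
    (ρ : Measure (EuclideanSpace ℝ (Fin d))) : Prop :=
  ∀ φ : C₀(EuclideanSpace ℝ (Fin d), ℝ),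
    Tendsto (fun n => ∫ x, φ x ∂(ρs n)) atTop (𝓝 (∫ x, φ x ∂ρ))

/-- The relaxed cost `C̄(ρ)`, the infimum of `liminf C(ρ_n)` over all sequences of probabilities
`ρ_n` converging weakly* to `ρ`. -/
def relaxedCost {d : ℕ} (N : ℕ) (ρ : Measure (EuclideanSpace ℝ (Fin d))) : ℝ≥0∞ :=
  ⨅ (ρs : ℕ → Measure (EuclideanSpace ℝ (Fin d)))
    (_ : (∀ n, IsProbabilityMeasure (ρs n)) ∧ WeakStarTendsto ρs ρ),
    liminf (fun n => transportCost N (ρs n)) atTop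

/-- The sub-probabilities `𝒫⁻` on `ℝ^d`. -/
def subProb (d : ℕ) : Set (Measure (EuclideanSpace ℝ (Fin d))) :=
  {ρ | ρ Set.univ ≤ 1}

/-- The functional `C̄(ρ) - ∫ V dρ`, with values in `(-∞,∞]`. -/
def energy {d : ℕ} (N : ℕ) (V : C₀(EuclideanSpace ℝ (Fin d), ℝ))
    (ρ : Measure (EuclideanSpace ℝ (Fin d))) : EReal :=
  (relaxedCost N ρ : EReal) - ((∫ x, V x ∂ρ : ℝ) : EReal)

/-- The set `𝒮_V` of the minimizers of `C̄(ρ) - ∫ V dρ` among the sub-probabilities. -/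
def minimizers {d : ℕ} (N : ℕ) (V : C₀(EuclideanSpace ℝ (Fin d), ℝ)) :
    Set (Measure (EuclideanSpace ℝ (Fin d))) :=
  {ρ | ρ ∈ subProb d ∧ IsMinOn (energy N V) (subProb d) ρ}

/-- The quantity `(1/k) ∑ φ(x_i) - c_k(x₁,…,x_k)`; it is `-∞` where two points coincide. -/
def dualValue {d : ℕ} (k : ℕ) (φ : C₀(EuclideanSpace ℝ (Fin d), ℝ))
    (x : Fin k → EuclideanSpace ℝ (Fin d)) : EReal :=
  (((1 / (k : ℝ)) * ∑ i, φ (x i) : ℝ) : EReal) - (cost k x : EReal)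

/-- `M_k(φ)`, the supremum over `(ℝ^d)^k` of `(1/k) ∑ φ(x_i) - c_k(x₁,…,x_k)`. For `k = 0` this
is `0`. -/
def M {d : ℕ} (k : ℕ) (φ : C₀(EuclideanSpace ℝ (Fin d), ℝ)) : EReal :=
  ⨆ x : Fin k → EuclideanSpace ℝ (Fin d), dualValue k φ x

end CoulombOT

end

namespace CoulombOT

variable {d : ℕ}

/-! Write `m` for `M N V` and take a real `t` strictly between the two sides of the hypothesis. A
point far away contributes almost nothing to `∑ V`, and deleting it does not raise the cost, so a
configuration with a point outside a suitable compact `K` has dual value at most `t < m`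
(`dualValue_succ_le`). Hence the supremum is attained on `K^N`. Moreover, if `φ ∈ C₀` has values in
`[0,1]` and equals `1` on `K`, the dual value is at most `t + (m - t) φ(x₀)`. Integrating against
plans and passing to weak* limits gives `C̄(ρ) - ∫ V dρ ≥ -t - (m - t) ∫ φ dρ`
(`ofReal_le_relaxedCost`), which exceeds `-m` when `‖ρ‖ < 1`. The empirical measure of a maximizer
has energy at most `-m` (`energy_empirical_le`), so no minimizer loses mass. -/

/-! ### Symmetry and monotonicity of the Coulomb cost -/

theorem cost_eq_sum_ite (k : ℕ) (x : Fin k → EuclideanSpace ℝ (Fin d)) :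
    cost k x = ∑ i, ∑ j, if i < j then (edist (x i) (x j))⁻¹ else 0 := by
  refine Finset.sum_congr rfl fun i _ => ?_
  rw [← Finset.sum_filter]
  congr 1
  ext j
  simp

/-- Removing a point does not increase the Coulomb cost. -/
theorem cost_comp_succAbove_le (n : ℕ) (x : Fin (n + 1) → EuclideanSpace ℝ (Fin d))
    (p : Fin (n + 1)) : cost n (fun i => x (p.succAbove i)) ≤ cost (n + 1) x := by
  rw [cost_eq_sum_ite, cost_eq_sum_ite, Fin.sum_univ_succAbove _ p]
  refine le_add_left (Finset.sum_le_sum fun i _ => ?_)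
  rw [Fin.sum_univ_succAbove _ p]
  refine le_add_left (Finset.sum_le_sum fun j _ => ?_)
  simp [Fin.succAbove_lt_succAbove_iff]

/-- Summing over ordered pairs removes the order on indices, so that permutations act by reindexing.
-/
theorem two_mul_cost (k : ℕ) (x : Fin k → EuclideanSpace ℝ (Fin d)) :
    2 * cost k x = ∑ i, ∑ j, if i ≠ j then (edist (x i) (x j))⁻¹ else 0 := by
  have h : cost k x = ∑ i, ∑ j, if j < i then (edist (x i) (x j))⁻¹ else 0 := by
    rw [cost_eq_sum_ite, Finset.sum_comm]
    simp only [edist_comm]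
  rw [two_mul]
  nth_rewrite 2 [h]
  rw [cost_eq_sum_ite, ← Finset.sum_add_distrib]
  refine Finset.sum_congr rfl fun i _ => ?_
  rw [← Finset.sum_add_distrib]
  refine Finset.sum_congr rfl fun j _ => ?_
  rcases lt_trichotomy i j with hij | hij | hij
  · simp [hij, hij.ne, hij.not_gt]
  · simp [hij]
  · simp [hij, hij.ne', hij.not_gt]

/-- The Coulomb cost is symmetric. -/
theorem cost_comp_perm (k : ℕ) (x : Fin k → EuclideanSpace ℝ (Fin d)) (σ : Equiv.Perm (Fin k)) :
    cost k (fun i => x (σ i)) = cost k x := by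
  refine (ENNReal.mul_right_inj two_ne_zero ENNReal.ofNat_ne_top).1 ?_
  rw [two_mul_cost, two_mul_cost,
    ← Equiv.sum_comp σ (fun i => ∑ j, if i ≠ j then (edist (x i) (x j))⁻¹ else 0)]
  refine Finset.sum_congr rfl fun i _ => ?_
  rw [← Equiv.sum_comp σ (fun j => if σ i ≠ j then (edist (x (σ i)) (x j))⁻¹ else 0)]
  simp [σ.injective.eq_iff]

theorem continuous_cost (k : ℕ) :
    Continuous (cost k : (Fin k → EuclideanSpace ℝ (Fin d)) → ℝ≥0∞) :=
  continuous_finsetSum _ fun i _ => continuous_finsetSum _ fun j _ =>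
    ((continuous_apply i).edist (continuous_apply j)).inv

/-! ### The dual value and its supremum -/

theorem continuous_dualValue (k : ℕ) (φ : C₀(EuclideanSpace ℝ (Fin d), ℝ)) :
    Continuous (dualValue k φ) := by
  rw [continuous_iff_continuousAt]
  intro x
  have h₁ : Continuous fun x : Fin k → EuclideanSpace ℝ (Fin d) =>
      (((1 / (k : ℝ)) * ∑ i, φ (x i) : ℝ) : EReal) := by
    refine continuous_coe_real_ereal.comp (continuous_const.mul ?_)
    exact continuous_finsetSum _ fun i _ => φ.continuous.comp (continuous_apply i)
  have h₂ : Continuous fun x : Fin k → EuclideanSpace ℝ (Fin d) => -(cost k x : EReal) :=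
    (continuous_coe_ennreal_ereal.comp (continuous_cost k)).neg
  -- Addition on `EReal` is continuous here because the first summand is finite.
  have h := EReal.continuousAt_add (p := (((1 / (k : ℝ)) * ∑ i, φ (x i) : ℝ), -(cost k x : EReal)))
    (.inl (EReal.coe_ne_top _)) (.inl (EReal.coe_ne_bot _))
  exact ContinuousAt.comp (f := fun x : Fin k → EuclideanSpace ℝ (Fin d) =>
    ((((1 / (k : ℝ)) * ∑ i, φ (x i) : ℝ) : EReal), -(cost k x : EReal))) h
    (h₁.prodMk h₂).continuousAt

/-- Moves bounds from `EReal` to `ℝ≥0∞`, where they can be integrated; truncation by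
`ENNReal.ofReal` loses nothing since the cost is nonnegative. -/
theorem dualValue_le_coe_iff {k : ℕ} {φ : C₀(EuclideanSpace ℝ (Fin d), ℝ)}
    {x : Fin k → EuclideanSpace ℝ (Fin d)} {r : ℝ} :
    dualValue k φ x ≤ r ↔ ENNReal.ofReal ((1 / (k : ℝ)) * ∑ i, φ (x i) - r) ≤ cost k x := by
  unfold dualValue
  generalize (1 / (k : ℝ)) * ∑ i, φ (x i) = a
  induction cost k x using ENNReal.recTopCoe with
  | top => simp
  | coe c =>
    rw [ENNReal.ofReal_le_iff_le_toReal ENNReal.coe_ne_top, ENNReal.coe_toReal,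
      show ((c : ℝ≥0∞) : EReal) = ((c : ℝ) : EReal) from rfl, ← EReal.coe_sub,
      EReal.coe_le_coe_iff]
    exact sub_le_comm

theorem dualValue_ne_top (k : ℕ) (φ : C₀(EuclideanSpace ℝ (Fin d), ℝ))
    (x : Fin k → EuclideanSpace ℝ (Fin d)) : dualValue k φ x ≠ ⊤ := by
  have h : dualValue k φ x ≤ ((1 / (k : ℝ) * ∑ i, φ (x i) : ℝ) : EReal) := by
    rw [dualValue_le_coe_iff, sub_self, ENNReal.ofReal_zero]
    exact zero_le
  exact ne_top_of_le_ne_top (EReal.coe_ne_top _) h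

/-- If one of the points lies where `|V|` is at most `ε`, the dual value of the whole configuration
exceeds by at most `ε` the dual value of the remaining points for the rescaled potential. -/
theorem dualValue_succ_le {n : ℕ} {V : C₀(EuclideanSpace ℝ (Fin d), ℝ)} {r ε : ℝ} (hε : 0 ≤ ε)
    (hr : M n (((((n + 1 : ℕ) : ℝ) - 1) / ((n + 1 : ℕ) : ℝ)) • V) ≤ r)
    {x : Fin (n + 1) → EuclideanSpace ℝ (Fin d)} {p : Fin (n + 1)} (hp : |V (x p)| ≤ ε) :
    dualValue (n + 1) V x ≤ ((r + ε : ℝ) : EReal) := by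
  have h := dualValue_le_coe_iff.1 ((le_iSup _ fun i => x (p.succAbove i)).trans hr)
  refine dualValue_le_coe_iff.2 ((ENNReal.ofReal_le_ofReal ?_).trans
    (h.trans (cost_comp_succAbove_le n x p)))
  have hn : (0 : ℝ) < n + 1 := by positivity
  have hV : 1 / ((n : ℝ) + 1) * V (x p) ≤ ε := by
    rw [one_div, inv_mul_le_iff₀ hn]
    nlinarith [le_abs_self (V (x p)), (Nat.cast_nonneg n : (0 : ℝ) ≤ n)]
  -- The factor `(N-1)/N` turns the weight `1/(N-1)` into `1/N`; for `n = 0` both sums are empty.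
  have hsum : 1 / (n : ℝ) * ∑ i, (((((n + 1 : ℕ) : ℝ) - 1) / ((n + 1 : ℕ) : ℝ)) • V)
      (x (p.succAbove i)) = 1 / ((n : ℝ) + 1) * ∑ i, V (x (p.succAbove i)) := by
    rcases Nat.eq_zero_or_pos n with rfl | hn0
    · simp
    · have : (n : ℝ) ≠ 0 := by positivity
      simp only [ZeroAtInftyContinuousMap.coe_smul, Pi.smul_apply, smul_eq_mul, ← Finset.mul_sum]
      push_cast
      field_simp
      ring
  rw [hsum, Fin.sum_univ_succAbove _ p, mul_add, Nat.cast_succ]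
  linarith

theorem exists_isCompact_abs_le (V : C₀(EuclideanSpace ℝ (Fin d), ℝ)) {ε : ℝ} (hε : 0 < ε) :
    ∃ K : Set (EuclideanSpace ℝ (Fin d)), IsCompact K ∧ ∀ y ∉ K, |V y| ≤ ε := by
  have h : ∀ᶠ y in cocompact _, |V y| ≤ ε := by
    filter_upwards [V.zero_at_infty'.eventually (Metric.closedBall_mem_nhds 0 hε)] with y hy
    simpa using hy
  obtain ⟨K, hK, hKs⟩ := mem_cocompact.1 h
  exact ⟨K, hK, fun y hy => hKs hy⟩

theorem exists_zeroAtInfty_one_on {K : Set (EuclideanSpace ℝ (Fin d))} (hK : IsCompact K) :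
    ∃ φ : C₀(EuclideanSpace ℝ (Fin d), ℝ), (∀ y ∈ K, φ y = 1) ∧ ∀ y, 0 ≤ φ y ∧ φ y ≤ 1 := by
  obtain ⟨f, hf, -, hfc, hf01⟩ :=
    exists_continuous_one_zero_of_isCompact hK isClosed_empty (Set.disjoint_empty K)
  exact ⟨⟨f, hfc.is_zero_at_infty⟩, fun y hy => hf hy, hf01⟩

theorem integrable_zeroAtInfty (φ : C₀(EuclideanSpace ℝ (Fin d), ℝ))
    (ρ : Measure (EuclideanSpace ℝ (Fin d))) [IsFiniteMeasure ρ] : Integrable φ ρ :=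
  φ.toBCF.integrable ρ

/-- The supremum of the dual value is attained if it is approached only by configurations of points
of a compact set. -/
theorem exists_dualValue_eq_M {k : ℕ} {V : C₀(EuclideanSpace ℝ (Fin d), ℝ)}
    {K : Set (EuclideanSpace ℝ (Fin d))} (hK : IsCompact K) {s : EReal} (hs : s < M k V)
    (h : ∀ x : Fin k → EuclideanSpace ℝ (Fin d), (∃ p, x p ∉ K) → dualValue k V x ≤ s) :
    ∃ x : Fin k → EuclideanSpace ℝ (Fin d), dualValue k V x = M k V := by
  obtain ⟨y, hy⟩ := lt_iSup_iff.1 hs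
  have hmem : ∀ x : Fin k → EuclideanSpace ℝ (Fin d), s < dualValue k V x →
      x ∈ Set.univ.pi fun _ => K := by
    intro x hx p _
    by_contra hp
    exact hx.not_ge (h x ⟨p, hp⟩)
  obtain ⟨x, -, hx⟩ := (isCompact_univ_pi fun _ => hK).exists_isMaxOn ⟨y, hmem y hy⟩
    (continuous_dualValue k V).continuousOn
  refine ⟨x, le_antisymm (le_iSup _ x) (iSup_le fun z => ?_)⟩
  by_cases hz : s < dualValue k V z
  · exact hx (hmem z hz)
  · exact (not_lt.1 hz).trans (hy.le.trans (hx (hmem y hy)))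

/-! ### Lower bounds by duality -/

/-- Weak duality with a majorant of the dual value that depends on one point. -/
theorem ofReal_le_transportCost {k : ℕ} {V g : C₀(EuclideanSpace ℝ (Fin d), ℝ)} {r : ℝ} (p : Fin k)
    (h : ∀ x : Fin k → EuclideanSpace ℝ (Fin d), dualValue k V x ≤ ((r + g (x p) : ℝ) : EReal))
    (ρ : Measure (EuclideanSpace ℝ (Fin d))) [IsProbabilityMeasure ρ] :
    ENNReal.ofReal (∫ y, V y ∂ρ - (r + ∫ y, g y ∂ρ)) ≤ transportCost k ρ := by
  refine le_iInf₂ fun P hP => ?_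
  obtain ⟨hP1, hPρ⟩ := hP
  have hint : ∀ (φ : C₀(EuclideanSpace ℝ (Fin d), ℝ)) (i : Fin k),
      Integrable (fun x : Fin k → EuclideanSpace ℝ (Fin d) => φ (x i)) P := fun φ i =>
    (integrable_map_measure φ.continuous.aestronglyMeasurable
      (measurable_pi_apply i).aemeasurable).1 (integrable_zeroAtInfty φ (P.map fun x => x i))
  have heq : ∀ (φ : C₀(EuclideanSpace ℝ (Fin d), ℝ)) (i : Fin k),
      ∫ x, φ (x i) ∂P = ∫ y, φ y ∂ρ := fun φ i => by
    rw [← hPρ i, integral_map (measurable_pi_apply i).aemeasurable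
      φ.continuous.aestronglyMeasurable]
  have hsum : Integrable (fun x : Fin k → EuclideanSpace ℝ (Fin d) =>
      1 / (k : ℝ) * ∑ i, V (x i)) P :=
    (integrable_finsetSum _ fun i _ => hint V i).const_mul _
  have hg : Integrable (fun x : Fin k → EuclideanSpace ℝ (Fin d) => r + g (x p)) P :=
    (integrable_const r).add (hint g p)
  have hk : (k : ℝ) ≠ 0 := Nat.cast_ne_zero.2 p.pos.ne'
  have hval : ∫ x, (1 / (k : ℝ) * ∑ i, V (x i) - (r + g (x p))) ∂P
      = ∫ y, V y ∂ρ - (r + ∫ y, g y ∂ρ) := by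
    rw [integral_sub hsum hg, integral_const_mul, integral_finsetSum _ fun i _ => hint V i,
      integral_add (integrable_const r) (hint g p)]
    simp [heq, hk]
  rw [← hval]
  calc
    -- The positive part allows a lower integral, with no integrability of the cost.
    _ ≤ ENNReal.ofReal (∫ x, max (1 / (k : ℝ) * ∑ i, V (x i) - (r + g (x p))) 0 ∂P) :=
      ENNReal.ofReal_le_ofReal (integral_mono (hsum.sub hg) (hsum.sub hg).pos_part
        fun x => le_max_left _ _)
    _ = ∫⁻ x, ENNReal.ofReal (max (1 / (k : ℝ) * ∑ i, V (x i) - (r + g (x p))) 0) ∂P :=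
      ofReal_integral_eq_lintegral_ofReal (hsum.sub hg).pos_part
        (ae_of_all _ fun x => le_max_right _ _)
    _ ≤ ∫⁻ x, cost k x ∂P := by
      refine lintegral_mono fun x => ?_
      rw [ENNReal.ofReal_max, ENNReal.ofReal_zero]
      exact max_le (dualValue_le_coe_iff.1 (h x)) zero_le

/-- The bound survives weak* limits because `V` and `g` lie in `C₀`. The constant `r` comes from the
probabilities `ρ_n`, so it is not scaled by the mass of `ρ`. -/
theorem ofReal_le_relaxedCost {k : ℕ} {V g : C₀(EuclideanSpace ℝ (Fin d), ℝ)} {r : ℝ} (p : Fin k)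
    (h : ∀ x : Fin k → EuclideanSpace ℝ (Fin d), dualValue k V x ≤ ((r + g (x p) : ℝ) : EReal))
    (ρ : Measure (EuclideanSpace ℝ (Fin d))) :
    ENNReal.ofReal (∫ y, V y ∂ρ - (r + ∫ y, g y ∂ρ)) ≤ relaxedCost k ρ := by
  refine le_iInf₂ fun ρs hρs => ?_
  have hlim : Tendsto (fun n => ENNReal.ofReal (∫ y, V y ∂(ρs n) - (r + ∫ y, g y ∂(ρs n)))) atTop
      (𝓝 (ENNReal.ofReal (∫ y, V y ∂ρ - (r + ∫ y, g y ∂ρ)))) :=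
    ENNReal.tendsto_ofReal ((hρs.2 V).sub (tendsto_const_nhds.add (hρs.2 g)))
  rw [← hlim.liminf_eq]
  refine liminf_le_liminf (Eventually.of_forall fun n => ?_)
  have := hρs.1 n
  exact ofReal_le_transportCost p h (ρs n)

theorem relaxedCost_le_transportCost (k : ℕ) (ρ : Measure (EuclideanSpace ℝ (Fin d)))
    [IsProbabilityMeasure ρ] : relaxedCost k ρ ≤ transportCost k ρ :=
  (iInf₂_le (fun _ => ρ) ⟨fun _ => inferInstance, fun _ => tendsto_const_nhds⟩).trans_eq
    (liminf_const _)

/-! ### Empirical measures as competitors -/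

/-- The uniform probability on the `n + 1` points of a configuration. -/
noncomputable def empirical {n : ℕ} (x : Fin (n + 1) → EuclideanSpace ℝ (Fin d)) :
    Measure (EuclideanSpace ℝ (Fin d)) :=
  ((n + 1 : ℕ) : ℝ≥0∞)⁻¹ • ∑ i, Measure.dirac (x i)

instance {n : ℕ} (x : Fin (n + 1) → EuclideanSpace ℝ (Fin d)) :
    IsProbabilityMeasure (empirical x) :=
  ⟨by
    rw [empirical, Measure.smul_apply, Measure.finsetSum_apply]
    simpa using ENNReal.inv_mul_cancel (Nat.cast_ne_zero.2 n.succ_ne_zero)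
      (ENNReal.natCast_ne_top (n + 1))⟩

theorem integral_empirical {n : ℕ} (x : Fin (n + 1) → EuclideanSpace ℝ (Fin d))
    (V : C₀(EuclideanSpace ℝ (Fin d), ℝ)) :
    ∫ y, V y ∂(empirical x) = 1 / ((n + 1 : ℕ) : ℝ) * ∑ i, V (x i) := by
  rw [empirical, integral_smul_measure, integral_finsetSum_measure
    fun i _ => integrable_zeroAtInfty V _, ENNReal.toReal_inv, ENNReal.toReal_natCast]
  simp

/-- The cyclic shifts of a configuration form a transport plan between its uniform
probabilities. -/
theorem transportCost_empirical_le {n : ℕ} (x : Fin (n + 1) → EuclideanSpace ℝ (Fin d)) :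
    transportCost (n + 1) (empirical x) ≤ cost (n + 1) x := by
  have hc : ((n + 1 : ℕ) : ℝ≥0∞)⁻¹ * ((n + 1 : ℕ) : ℝ≥0∞) = 1 :=
    ENNReal.inv_mul_cancel (Nat.cast_ne_zero.2 n.succ_ne_zero) (ENNReal.natCast_ne_top (n + 1))
  set P : Measure (Fin (n + 1) → EuclideanSpace ℝ (Fin d)) :=
    ((n + 1 : ℕ) : ℝ≥0∞)⁻¹ • ∑ s : Fin (n + 1), Measure.dirac fun i => x (i + s) with hP
  have hmem : P ∈ plans (n + 1) (empirical x) := by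
    refine ⟨⟨?_⟩, fun i => ?_⟩
    · rw [hP, Measure.smul_apply, Measure.finsetSum_apply]
      simpa using hc
    · ext A hA
      have hi : MeasurableSet ((fun z : Fin (n + 1) → EuclideanSpace ℝ (Fin d) => z i) ⁻¹' A) :=
        measurable_pi_apply i hA
      rw [Measure.map_apply (measurable_pi_apply i) hA, hP, empirical, Measure.smul_apply,
        Measure.smul_apply, Measure.finsetSum_apply, Measure.finsetSum_apply,
        ← Equiv.sum_comp (Equiv.addLeft i) fun j => Measure.dirac (x j) A]
      congr 1
      refine Finset.sum_congr rfl fun s _ => ?_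
      rw [Measure.dirac_apply' _ hi, Measure.dirac_apply' _ hA]
      rfl
  refine (iInf₂_le P hmem).trans_eq ?_
  have hperm : ∀ s : Fin (n + 1), cost (n + 1) (fun i => x (i + s)) = cost (n + 1) x := fun s =>
    cost_comp_perm (n + 1) x (Equiv.addRight s)
  rw [hP, lintegral_smul_measure, lintegral_finsetSum_measure]
  simp only [lintegral_dirac' _ (continuous_cost (n + 1)).measurable, hperm, Finset.sum_const,
    Finset.card_univ, Fintype.card_fin, nsmul_eq_mul, smul_eq_mul]
  rw [← mul_assoc, hc, one_mul]

theorem energy_empirical_le {n : ℕ} (V : C₀(EuclideanSpace ℝ (Fin d), ℝ))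
    (x : Fin (n + 1) → EuclideanSpace ℝ (Fin d)) :
    energy (n + 1) V (empirical x) ≤ -dualValue (n + 1) V x := by
  rw [energy, dualValue, integral_empirical,
    EReal.neg_sub (.inl (EReal.coe_ne_bot _)) (.inl (EReal.coe_ne_top _)), sub_eq_add_neg,
    add_comm]
  exact add_le_add le_rfl (EReal.coe_ennreal_le_coe_ennreal_iff.2
    ((relaxedCost_le_transportCost _ _).trans (transportCost_empirical_le x)))

end CoulombOT

/-! ### Conclusion -/

open CoulombOT in
theorem mainTheorem6 (d N : ℕ) (hd : 1 ≤ d) (hN : 1 ≤ N)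
    (V : C₀(EuclideanSpace ℝ (Fin d), ℝ))
    (hV : CoulombOT.M (N - 1) ((((N : ℝ) - 1) / (N : ℝ)) • V) < CoulombOT.M N V) :
    (∀ ρ ∈ CoulombOT.minimizers N V, IsProbabilityMeasure ρ) ∧
      ∃ x : Fin N → EuclideanSpace ℝ (Fin d),
        CoulombOT.dualValue N V x = CoulombOT.M N V := by
  obtain ⟨n, rfl⟩ := Nat.exists_eq_add_of_le' hN
  rw [Nat.add_sub_cancel] at hV
  obtain ⟨r, hr, hrM⟩ := EReal.lt_iff_exists_real_btwn.1 hV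
  -- The gap `t - r` is the tolerance for `|V|` outside `K`.
  obtain ⟨t, hrt, htM⟩ := EReal.lt_iff_exists_real_btwn.1 hrM
  rw [EReal.coe_lt_coe_iff] at hrt
  obtain ⟨K, hK, hVK⟩ := exists_isCompact_abs_le V (sub_pos.2 hrt)
  have hfar : ∀ x : Fin (n + 1) → EuclideanSpace ℝ (Fin d), (∃ p, x p ∉ K) →
      dualValue (n + 1) V x ≤ (t : EReal) := by
    rintro x ⟨p, hp⟩
    simpa using dualValue_succ_le (sub_pos.2 hrt).le hr.le (hVK _ hp)
  obtain ⟨x, hx⟩ := exists_dualValue_eq_M hK htM hfar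
  refine ⟨fun ρ hρ => ?_, x, hx⟩
  obtain ⟨m, hm⟩ : ∃ m : ℝ, M (n + 1) V = m := by
    refine ⟨(M (n + 1) V).toReal, (EReal.coe_toReal ?_ (bot_le.trans_lt htM).ne').symm⟩
    rw [← hx]
    exact dualValue_ne_top (n + 1) V x
  rw [hm, EReal.coe_lt_coe_iff] at htM
  obtain ⟨hρ1, hmin⟩ := hρ
  have : IsFiniteMeasure ρ := ⟨(show ρ Set.univ ≤ 1 from hρ1).trans_lt ENNReal.one_lt_top⟩
  by_contra hprob
  have hlt : ρ.real Set.univ < 1 := by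
    have : ρ Set.univ < 1 := lt_of_le_of_ne hρ1 fun h => hprob ⟨h⟩
    exact (ENNReal.toReal_lt_toReal (measure_ne_top _ _) ENNReal.one_ne_top).2 this
  obtain ⟨φ, hφK, hφ⟩ := exists_zeroAtInfty_one_on hK
  have hφρ : ∫ y, φ y ∂ρ < 1 := by
    refine lt_of_le_of_lt ?_ hlt
    simpa using integral_mono (integrable_zeroAtInfty φ ρ) (integrable_const (1 : ℝ))
      fun y => (hφ y).2
  have hmaj : ∀ z : Fin (n + 1) → EuclideanSpace ℝ (Fin d),
      dualValue (n + 1) V z ≤ ((t + ((m - t) • φ) (z 0) : ℝ) : EReal) := by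
    intro z
    rw [ZeroAtInftyContinuousMap.smul_apply, smul_eq_mul]
    by_cases hz : z 0 ∈ K
    · rw [hφK _ hz, mul_one, add_sub_cancel, ← hm]
      exact le_iSup _ z
    · refine (hfar z ⟨0, hz⟩).trans (EReal.coe_le_coe_iff.2 ?_)
      nlinarith [hφ (z 0)]
  have hlow := ofReal_le_relaxedCost 0 hmaj ρ
  have hint : ∫ y, ((m - t) • φ) y ∂ρ = (m - t) * ∫ y, φ y ∂ρ := integral_const_mul _ _
  have hup : energy (n + 1) V ρ ≤ ((-m : ℝ) : EReal) := by
    refine (hmin (show empirical x ∈ subProb d from prob_le_one)).trans ?_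
    refine (energy_empirical_le V x).trans_eq ?_
    rw [hx, hm, EReal.coe_neg]
  have hcost : (relaxedCost (n + 1) ρ : EReal) ≤ ((-m + ∫ y, V y ∂ρ : ℝ) : EReal) := by
    rw [EReal.coe_add]
    exact (EReal.sub_le_iff_le_add (.inl (EReal.coe_ne_bot _)) (.inl (EReal.coe_ne_top _))).1 hup
  have hfin := (EReal.coe_ennreal_le_coe_ennreal_iff.2 hlow).trans hcost
  rw [EReal.coe_ennreal_ofReal, EReal.coe_le_coe_iff, hint] at hfin
  have := (le_max_left _ _).trans hfin
  -- What remains is `(m - t) (1 - ∫ φ dρ) ≤ 0`, although both factors are positive.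
  nlinarith
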